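/- For positive integers $L,s,k$ with $L\ge 3$ and $s+1\le k\le L+s$, let $I_{L,s,k}$ be the set of integer partitions whose smallest part is $s$, all of whose parts are at most $L+s$, and in which $k$ does not appear as a part; let $D_{L,s}$ be the set of nonempty integer partitions all of whose parts lie in $\{s+1,\dots,L+s\}$. Write $|\pi|$ for the sum of the parts of a partition $\pi$. Put $$P_{M,s}=(s+1)(s+2)\cdots(s+M),$$ $$\gamma(M,s)=\bigl((s+1)+(s+2)+\cdots+(s+M)\bigr)\Bigl(P_{M,s}^{(P_{M,s}^2-1)M+2}+\bigl((P_{M,s}^2-1)M-2\bigr)P_{M,s}\Bigr),$$ and $\Gamma(s)=\gamma(3s+2,s)$. Then $$\bigl|\{\pi\in I_{L,s,k}:|\pi|=N\}\bigr|>\bigl|\{\pi\in D_{L,s}:|\pi|=N\}\bigr|\qquad\text{for all } N\ge\Gamma(s).$$ -/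

import Mathlib

namespace IntervalPartition

/-- The partitions of `N` that lie in `I_{L,s,k}`: the smallest part is `s`, all parts are
at most `L + s`, and `k` is not a part. -/
def partI (L s k N : ℕ) : Finset N.Partition :=
  Finset.univ.filter fun π =>
    (s ∈ π.parts ∧ ∀ i ∈ π.parts, s ≤ i) ∧ (∀ i ∈ π.parts, i ≤ L + s) ∧ k ∉ π.parts

/-- The partitions of `N` that lie in `D_{L,s}`: nonempty, with all parts in
`{s + 1, …, L + s}`. -/
def partD (L s N : ℕ) : Finset N.Partition :=
  Finset.univ.filter fun π =>
    π.parts ≠ 0 ∧ ∀ i ∈ π.parts, i ∈ Finset.Icc (s + 1) (L + s)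

/-- `P_{L,s} = (s + 1)(s + 2) ⋯ (s + L)`. -/
def P (L s : ℕ) : ℕ := ∏ i ∈ Finset.Icc 1 L, (s + i)

/-- `γ(L,s) = ((s+1) + ⋯ + (s+L)) * (P^((P^2-1)L+2) + ((P^2-1)L-2) P)` with `P = P_{L,s}`.
For `L ≥ 3` and `s ≥ 1` one has `P ≥ 24`, so no subtraction truncates. -/
def gammaBound (L s : ℕ) : ℕ :=
  (∑ i ∈ Finset.Icc 1 L, (s + i)) *
    (P L s ^ ((P L s ^ 2 - 1) * L + 2) + ((P L s ^ 2 - 1) * L - 2) * P L s)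

/-- `Γ(s) = γ(3s + 2, s)`. -/
def GammaBound (s : ℕ) : ℕ := gammaBound (3 * s + 2) s

end IntervalPartition

namespace IntervalPartition

open Finset

/-! Choose two parts `A = g * a` and `B = g * b` in `{s+1, s+2, s+3}`, both different from `k`, with
gcd `g`. Fix the multiset `t` of parts other than `A`, `B` and the special part (`s` for `I`, `k`
for `D`), and put `n = N - t.sum`. It remains to compare solutions of `s j + A x + B y = n`, `j ≥
1`, with those of `k j + A x + B y = n`, `j ≥ 0`. With `l = lcm(A, B)`, each admissible `j` gives
`(n - c j) / l` pairs `(x, y)` up to an error of 1, where `c` is `s` or `k`. As `k ≥ s + 1`, the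
excess grows quadratically in `n` (`lcm_mul_card_triples_sub`).

The excess can be negative only for `n < n₀`, where it is at least `-n₀ ^ 2`. Such `t` have nearly
full sum, and they number at most `2 * n₀` times the `t` with `n ≥ n₁` (`card_near_le`), whose
excess is more than `2 * n₀ ^ 3`. Hence the total over `t` is positive (`sum_boundedMultisets_pos`).
Nothing depends on `L`, since `A, B ≤ s + 3`. -/

/-! ### Counting solutions of linear equations in two and three unknowns -/

/-- The solutions `(x, y)` in natural numbers of `a x + b y = m`. -/
def pairs (a b m : ℕ) : Finset (ℕ × ℕ) :=
  (range (m + 1) ×ˢ range (m + 1)).filter fun p => a * p.1 + b * p.2 = m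

/-- The solutions `(j, x, y)` in natural numbers, with `t ≤ j`, of `c j + a x + b y = n`. -/
def triples (t c a b n : ℕ) : Finset (ℕ × ℕ × ℕ) :=
  (range (n + 1) ×ˢ range (n + 1) ×ˢ range (n + 1)).filter fun p =>
    t ≤ p.1 ∧ c * p.1 + a * p.2.1 + b * p.2.2 = n

theorem mem_pairs {a b m : ℕ} (ha : 0 < a) (hb : 0 < b) (p : ℕ × ℕ) :
    p ∈ pairs a b m ↔ a * p.1 + b * p.2 = m := by
  simp only [pairs, mem_filter, mem_product, mem_range, and_iff_right_iff_imp]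
  intro h
  have h1 : p.1 ≤ a * p.1 := Nat.le_mul_of_pos_left _ ha
  have h2 : p.2 ≤ b * p.2 := Nat.le_mul_of_pos_left _ hb
  omega

theorem mem_triples {t c a b n : ℕ} (hc : 0 < c) (ha : 0 < a) (hb : 0 < b) (p : ℕ × ℕ × ℕ) :
    p ∈ triples t c a b n ↔ t ≤ p.1 ∧ c * p.1 + a * p.2.1 + b * p.2.2 = n := by
  simp only [triples, mem_filter, mem_product, mem_range, and_iff_right_iff_imp]
  rintro ⟨-, h⟩
  have h0 : p.1 ≤ c * p.1 := Nat.le_mul_of_pos_left _ hc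
  have h1 : p.2.1 ≤ a * p.2.1 := Nat.le_mul_of_pos_left _ ha
  have h2 : p.2.2 ≤ b * p.2.2 := Nat.le_mul_of_pos_left _ hb
  omega

theorem card_triples {t c a b n : ℕ} (hc : 0 < c) (ha : 0 < a) (hb : 0 < b) :
    (triples t c a b n).card =
      ∑ j ∈ (range (n + 1)).filter (fun j => t ≤ j ∧ c * j ≤ n), (pairs a b (n - c * j)).card := by
  rw [← card_sigma]
  refine card_bij' (fun p _ => ⟨p.1, p.2⟩) (fun p _ => (p.1, p.2)) ?_ ?_ ?_ ?_
  · intro p hp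
    rw [mem_triples hc ha hb] at hp
    have h0 : p.1 ≤ c * p.1 := Nat.le_mul_of_pos_left _ hc
    simp only [mem_sigma, mem_filter, mem_range, mem_pairs ha hb]
    omega
  · intro p hp
    simp only [mem_sigma, mem_filter, mem_range, mem_pairs ha hb] at hp
    rw [mem_triples hc ha hb]
    dsimp only
    omega
  · intro p _; rfl
  · intro p _; rfl

theorem card_triples_le {t c a b n : ℕ} (hb : 0 < b) :
    (triples t c a b n).card ≤ (n + 1) ^ 2 := by
  have h : ((range (n + 1)) ×ˢ (range (n + 1))).card = (n + 1) ^ 2 := by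
    rw [card_product, card_range, sq]
  rw [← h]
  refine card_le_card_of_injOn (fun p => (p.1, p.2.1)) ?_ ?_
  · intro p hp
    simp only [triples, coe_filter, mem_product, Set.mem_ofPred_eq] at hp
    simp only [coe_product, Set.mem_prod, mem_coe]
    exact ⟨hp.1.1, hp.1.2.1⟩
  · rintro ⟨j, x, y⟩ hp ⟨j', x', y'⟩ hp' h
    simp only [triples, coe_filter, Set.mem_ofPred_eq] at hp hp'
    simp only [Prod.mk.injEq] at h
    obtain ⟨rfl, rfl⟩ := h
    have : b * y = b * y' := by omega
    rw [Nat.eq_of_mul_eq_mul_left hb this]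

theorem card_pairs_le {g a b : ℕ} (hg : 0 < g) (ha : 0 < a) (hb : 0 < b)
    (hab : Nat.Coprime a b) (m : ℕ) :
    (pairs (g * a) (g * b) m).card ≤ m / (g * a * b) + 1 := by
  have hga : 0 < g * a := Nat.mul_pos hg ha
  have hgb : 0 < g * b := Nat.mul_pos hg hb
  rw [← card_range (m / (g * a * b) + 1)]
  -- All solutions share the residue of `x` modulo `b`, so `x / b` determines the solution.
  refine card_le_card_of_injOn (fun p => p.1 / b) ?_ ?_
  · intro p hp
    rw [mem_coe, mem_pairs hga hgb] at hp
    simp only [coe_range, Set.mem_Iio]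
    rw [Nat.lt_succ_iff, ← Nat.div_div_eq_div_mul]
    refine Nat.div_le_div_right ?_
    rw [Nat.le_div_iff_mul_le hga]
    linarith [Nat.zero_le (g * b * p.2), mul_comm p.1 (g * a)]
  · rintro ⟨x, y⟩ hp ⟨x', y'⟩ hp' h
    rw [mem_coe, mem_pairs hga hgb] at hp hp'
    dsimp only at hp hp' h
    have e : a * x + b * y = a * x' + b * y' := by
      apply Nat.eq_of_mul_eq_mul_left hg
      linarith
    have hmod : x ≡ x' [MOD b] := by
      have : a * x ≡ a * x' [MOD b] := by
        have h1 : a * x + b * y ≡ a * x' + b * y' [MOD b] := by rw [e]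
        simpa [Nat.ModEq] using h1
      exact Nat.ModEq.cancel_left_of_coprime hab.symm this
    have hx : x = x' := by
      rw [← Nat.div_add_mod x b, ← Nat.div_add_mod x' b, h, hmod]
    subst hx
    have : b * y = b * y' := by omega
    rw [Nat.eq_of_mul_eq_mul_left hb this]

theorem le_card_pairs {g a b : ℕ} (hg : 0 < g) (ha : 0 < a) (hb : 0 < b)
    (hab : Nat.Coprime a b) {m : ℕ} (hm : g ∣ m) :
    m / (g * a * b) ≤ (pairs (g * a) (g * b) m).card := by
  have hga : 0 < g * a := Nat.mul_pos hg ha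
  have hgb : 0 < g * b := Nat.mul_pos hg hb
  obtain ⟨r, rfl⟩ := hm
  have hdiv : g * r / (g * a * b) = r / (a * b) := by
    rw [mul_assoc, Nat.mul_div_mul_left _ _ hg]
  rw [hdiv]
  obtain ⟨x₀, hx₀, hx₀'⟩ : ∃ x₀, x₀ < b ∧ a * x₀ ≡ r [MOD b] := by
    let z := Nat.chineseRemainder hab 0 r
    obtain ⟨w, hw⟩ := (Nat.modEq_zero_iff_dvd).1 z.2.1
    refine ⟨w % b, Nat.mod_lt _ hb, ?_⟩
    have h2 : a * w ≡ r [MOD b] := hw ▸ z.2.2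
    exact (Nat.ModEq.mul_left a (Nat.mod_modEq w b)).trans h2
  conv_lhs => rw [← card_range (r / (a * b))]
  refine card_le_card_of_injOn (fun i => (x₀ + i * b, (r - a * (x₀ + i * b)) / b)) ?_ ?_
  · intro i hi
    simp only [coe_range, Set.mem_Iio] at hi
    rw [mem_coe, mem_pairs hga hgb]
    dsimp only
    have hle : a * (x₀ + i * b) ≤ r := by
      have h1 : a * (x₀ + i * b) ≤ (a * b) * (i + 1) := by nlinarith
      exact h1.trans ((Nat.mul_le_mul_left _ hi).trans (Nat.mul_div_le _ _))
    have hmod : a * (x₀ + i * b) ≡ r [MOD b] := by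
      refine Nat.ModEq.trans ?_ hx₀'
      rw [mul_add]
      have : a * (i * b) ≡ 0 [MOD b] := by
        rw [Nat.modEq_zero_iff_dvd, ← mul_assoc]; exact dvd_mul_left _ _
      simpa using Nat.ModEq.add_left (a * x₀) this
    have hd : b ∣ r - a * (x₀ + i * b) := (Nat.modEq_iff_dvd' hle).1 hmod
    rw [mul_assoc, mul_assoc g b, Nat.mul_div_cancel' hd, ← mul_add, Nat.add_sub_cancel' hle]
  · intro i _ i' _ h
    simp only [Prod.mk.injEq] at h
    exact Nat.eq_of_mul_eq_mul_right hb (by omega)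

theorem lcm_mul_card_pairs_le {g a b : ℕ} (hg : 0 < g) (ha : 0 < a) (hb : 0 < b)
    (hab : Nat.Coprime a b) (m : ℕ) :
    ((g * a * b : ℕ) : ℤ) * (pairs (g * a) (g * b) m).card ≤ m + (g * a * b : ℕ) := by
  have h1 := Nat.mul_le_mul_left (g * a * b) (card_pairs_le hg ha hb hab m)
  have h2 := Nat.mul_div_le m (g * a * b)
  rw [mul_add, mul_one] at h1
  exact_mod_cast h1.trans (Nat.add_le_add_right h2 _)

theorem le_lcm_mul_card_pairs {g a b : ℕ} (hg : 0 < g) (ha : 0 < a) (hb : 0 < b)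
    (hab : Nat.Coprime a b) {m : ℕ} (hm : g ∣ m) :
    (m : ℤ) - (g * a * b : ℕ) ≤ ((g * a * b : ℕ) : ℤ) * (pairs (g * a) (g * b) m).card := by
  have h1 := Nat.mul_le_mul_left (g * a * b) (le_card_pairs hg ha hb hab hm)
  have h2 := Nat.div_add_mod m (g * a * b)
  have h3 := Nat.mod_lt m (Nat.mul_pos (Nat.mul_pos hg ha) hb)
  have h4 : m ≤ g * a * b * (pairs (g * a) (g * b) m).card + g * a * b := by omega
  have h5 : (m : ℤ) ≤ ((g * a * b : ℕ) : ℤ) * (pairs (g * a) (g * b) m).card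
    + (g * a * b : ℕ) := by exact_mod_cast h4
  linarith

theorem card_pairs_eq_zero {g a b m : ℕ} (hm : ¬ g ∣ m) : (pairs (g * a) (g * b) m).card = 0 := by
  rw [card_eq_zero, pairs, filter_eq_empty_iff]
  rintro p - h
  exact hm ⟨a * p.1 + b * p.2, by rw [← h]; ring⟩

theorem dvd_sub_mul_iff {g c j n : ℕ} (hc : g ∣ c + 1) (h : c * j ≤ n) :
    g ∣ n - c * j ↔ g ∣ n + j := by
  have : n + j = (n - c * j) + (c + 1) * j := by
    rw [add_mul, one_mul]; omega
  rw [this]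
  exact (Nat.dvd_add_left (hc.mul_right j)).symm

/-! ### Quadratic growth of the excess for a fixed rest -/

/-- The indices in `[t, M]` that are congruent to `-n` modulo `g`. -/
def classIdx (g n t M : ℕ) : Finset ℕ := (Icc t M).filter fun j => g ∣ n + j

theorem le_lcm_mul_card_triples {g a b s n : ℕ} (hg : 0 < g) (ha : 0 < a) (hb : 0 < b)
    (hab : Nat.Coprime a b) (hs : 0 < s) (hgs : g ∣ s + 1) :
    ∑ j ∈ classIdx g n 1 (n / (s + 1)), ((n : ℤ) - s * j - (g * a * b : ℕ)) ≤
      ((g * a * b : ℕ) : ℤ) * (triples 1 s (g * a) (g * b) n).card := by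
  rw [card_triples hs (Nat.mul_pos hg ha) (Nat.mul_pos hg hb), Nat.cast_sum, mul_sum]
  have hle : ∀ j, j ≤ n / (s + 1) → (s + 1) * j ≤ n := fun j hj =>
    (Nat.mul_le_mul_left _ hj).trans (Nat.mul_div_le _ _)
  refine le_trans (sum_le_sum (g := fun j => ((g * a * b : ℕ) : ℤ) *
    ((pairs (g * a) (g * b) (n - s * j)).card : ℕ)) ?_) (sum_le_sum_of_subset_of_nonneg ?_ ?_)
  · intro j hj
    simp only [classIdx, mem_filter, mem_Icc] at hj
    have h1 := hle j hj.1.2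
    have h2 : s * j ≤ n := by nlinarith
    have h3 := le_lcm_mul_card_pairs hg ha hb hab ((dvd_sub_mul_iff hgs h2).2 hj.2)
    rw [Nat.cast_sub h2] at h3
    push_cast at h3 ⊢
    linarith
  · intro j hj
    simp only [classIdx, mem_filter, mem_Icc] at hj
    have h1 := hle j hj.1.2
    simp only [mem_filter, mem_range]
    refine ⟨?_, hj.1.1, ?_⟩ <;> nlinarith
  · intros; positivity

theorem lcm_mul_card_triples_le {g a b s k n : ℕ} (hg : 0 < g) (ha : 0 < a) (hb : 0 < b)
    (hab : Nat.Coprime a b) (hk : s + 1 ≤ k) (hgk : g ∣ k + 1) :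
    ((g * a * b : ℕ) : ℤ) * (triples 0 k (g * a) (g * b) n).card ≤
      ∑ j ∈ classIdx g n 0 (n / (s + 1)), ((n : ℤ) - (s + 1) * j + (g * a * b : ℕ)) := by
  rw [card_triples (by omega) (Nat.mul_pos hg ha) (Nat.mul_pos hg hb), Nat.cast_sum, mul_sum]
  have hle : ∀ j, j ≤ n / (s + 1) → (s + 1) * j ≤ n := fun j hj =>
    (Nat.mul_le_mul_left _ hj).trans (Nat.mul_div_le _ _)
  have hnn : ∀ j ∈ classIdx g n 0 (n / (s + 1)),
      (0 : ℤ) ≤ (n : ℤ) - (s + 1) * j + (g * a * b : ℕ) := by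
    intro j hj
    simp only [classIdx, mem_filter, mem_Icc] at hj
    have h1 : (((s + 1) * j : ℕ) : ℤ) ≤ n := by exact_mod_cast hle j hj.1.2
    have h2 : (0 : ℤ) ≤ ((g * a * b : ℕ) : ℤ) := by positivity
    push_cast at h1 h2 ⊢
    linarith
  rw [← sum_filter_add_sum_filter_not _ (fun j => g ∣ n + j)]
  have hz : ∑ j ∈ ((range (n + 1)).filter (fun j => 0 ≤ j ∧ k * j ≤ n)).filter
      (fun j => ¬ g ∣ n + j), ((g * a * b : ℕ) : ℤ) *
        ((pairs (g * a) (g * b) (n - k * j)).card : ℕ) = 0 := by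
    refine sum_eq_zero fun j hj => ?_
    simp only [mem_filter] at hj
    rw [card_pairs_eq_zero]
    · simp
    · rw [dvd_sub_mul_iff hgk hj.1.2.2]
      exact hj.2
  rw [hz, add_zero]
  refine le_trans (sum_le_sum (g := fun j : ℕ => (n : ℤ) - (s + 1) * j + (g * a * b : ℕ)) ?_)
    (sum_le_sum_of_subset_of_nonneg ?_ ?_)
  · intro j hj
    simp only [mem_filter] at hj
    have h3 := lcm_mul_card_pairs_le hg ha hb hab (n - k * j)
    rw [Nat.cast_sub hj.1.2.2] at h3
    -- Replacing `k` by `s + 1` only raises the bound, and makes it comparable with the sum for `s`.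
    have h4 : (((s + 1) * j : ℕ) : ℤ) ≤ ((k * j : ℕ) : ℤ) := by
      exact_mod_cast Nat.mul_le_mul_right j hk
    push_cast at h3 h4 ⊢
    linarith
  · intro j hj
    simp only [mem_filter] at hj
    simp only [classIdx, mem_filter, mem_Icc]
    refine ⟨⟨Nat.zero_le _, ?_⟩, hj.2⟩
    rw [Nat.le_div_iff_mul_le (by omega)]
    nlinarith [hj.1.2.2]
  · intro j hj _
    exact hnn j hj

theorem le_card_classIdx {g n t q : ℕ} (hg : g = 1 ∨ g = 2) (ht : 4 * q ≤ t) :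
    q ≤ ((classIdx g n 1 t).filter (fun j => 2 * q ≤ j)).card := by
  conv_lhs => rw [← card_range q]
  -- The last summand gives `j` the parity of `n`, as needed when `g = 2`.
  refine card_le_card_of_injOn (fun i => 2 * q + 2 * i + (if g ∣ n then 0 else 1)) ?_ ?_
  · intro i hi
    simp only [coe_range, Set.mem_Iio] at hi
    simp only [classIdx, coe_filter, mem_filter, mem_Icc, Set.mem_ofPred_eq]
    refine ⟨⟨⟨?_, ?_⟩, ?_⟩, ?_⟩
    · split_ifs <;> omega
    · split_ifs <;> omega
    · rcases hg with rfl | rfl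
      · exact one_dvd _
      · split_ifs <;> omega
    · omega
  · intro i _ i' _ h
    dsimp only at h
    omega

theorem le_sum_classIdx {g n t q l : ℕ} (hg : g = 1 ∨ g = 2) (hl : 0 < l) (hlq : l ≤ q)
    (ht : 4 * q ≤ t) :
    2 * (q : ℤ) * (q - l) - 4 * l ^ 2 ≤ ∑ j ∈ classIdx g n 1 t, ((j : ℤ) - 2 * l) := by
  have hlq' : (l : ℤ) ≤ q := by exact_mod_cast hlq
  -- At least `q` indices contribute `2 * (q - l)` or more, at most `2 * l` indices are negative,
  -- and the rest are dropped.
  have h1 : ∑ j ∈ classIdx g n 1 t, ((if 2 * q ≤ j then 2 * ((q : ℤ) - l) else 0) +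
      (if j < 2 * l then -(2 * (l : ℤ)) else 0)) ≤ ∑ j ∈ classIdx g n 1 t, ((j : ℤ) - 2 * l) := by
    refine sum_le_sum fun j _ => ?_
    split_ifs <;> omega
  refine le_trans ?_ h1
  rw [sum_add_distrib, ← sum_filter, ← sum_filter, sum_const, sum_const, nsmul_eq_mul,
    nsmul_eq_mul]
  have h2 : q ≤ ((classIdx g n 1 t).filter (fun j => 2 * q ≤ j)).card :=
    le_card_classIdx hg ht
  have h3 : ((classIdx g n 1 t).filter (fun j => j < 2 * l)).card ≤ 2 * l := by
    conv_rhs => rw [← card_range (2 * l)]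
    refine card_le_card fun j hj => ?_
    rw [mem_filter] at hj
    exact mem_range.2 hj.2
  have h2' : (q : ℤ) ≤ ((classIdx g n 1 t).filter (fun j => 2 * q ≤ j)).card := by
    exact_mod_cast h2
  have h3' : (((classIdx g n 1 t).filter (fun j => j < 2 * l)).card : ℤ) ≤ 2 * l := by
    exact_mod_cast h3
  have hl' : (0 : ℤ) < l := by exact_mod_cast hl
  nlinarith [mul_le_mul_of_nonneg_right h2' (sub_nonneg.2 hlq'),
    mul_le_mul_of_nonneg_right h3' hl'.le]

/-- The excess of solutions with part `s` over solutions with part `k`. -/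
theorem lcm_mul_card_triples_sub {g a b s k n q : ℕ} (hg : g = 1 ∨ g = 2) (ha : 0 < a)
    (hb : 0 < b) (hab : Nat.Coprime a b) (hs : 0 < s) (hgs : g ∣ s + 1) (hk : s + 1 ≤ k)
    (hgk : g ∣ k + 1) (hsl : s + 1 ≤ g * a * b) (hq : 6 * (g * a * b) ≤ q)
    (hqn : q = n / (s + 1) / 4) :
    (q : ℤ) ^ 2 - 9 * (g * a * b : ℕ) ^ 2 ≤ ((g * a * b : ℕ) : ℤ) *
      ((triples 1 s (g * a) (g * b) n).card - (triples 0 k (g * a) (g * b) n).card) := by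
  have hg0 : 0 < g := by omega
  have hT := le_lcm_mul_card_triples (n := n) hg0 ha hb hab hs hgs
  have hU := lcm_mul_card_triples_le (n := n) hg0 ha hb hab hk hgk
  set l := g * a * b with hl
  have hl0 : 0 < l := by omega
  have hS := le_sum_classIdx (n := n) (t := n / (s + 1)) (q := q) hg hl0 (by omega) (by omega)
  -- The index `j = 0` occurs only for `k` and costs at most `n + l`, which is linear in `q` by `hn`
  -- below.
  have hsplit : ∑ j ∈ classIdx g n 0 (n / (s + 1)), ((n : ℤ) - (s + 1) * j + (l : ℕ)) ≤
      (n + l) + ∑ j ∈ classIdx g n 1 (n / (s + 1)), ((n : ℤ) - (s + 1) * j + (l : ℕ)) := by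
    have hsub : classIdx g n 0 (n / (s + 1)) ⊆ insert 0 (classIdx g n 1 (n / (s + 1))) := by
      intro j hj
      simp only [classIdx, mem_insert, mem_filter, mem_Icc] at hj ⊢
      rcases Nat.eq_zero_or_pos j with h | h
      · exact Or.inl h
      · exact Or.inr ⟨⟨h, hj.1.2⟩, hj.2⟩
    have hnot : 0 ∉ classIdx g n 1 (n / (s + 1)) := by simp [classIdx]
    refine (sum_le_sum_of_subset_of_nonneg hsub ?_).trans ?_
    · intro j hj _
      have hj' : j ≤ n / (s + 1) := by
        simp only [classIdx, mem_insert, mem_filter, mem_Icc] at hj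
        omega
      have h1 : (((s + 1) * j : ℕ) : ℤ) ≤ n := by
        exact_mod_cast (Nat.mul_le_mul_left _ hj').trans (Nat.mul_div_le _ _)
      push_cast at h1
      linarith [Int.natCast_nonneg l]
    · rw [sum_insert hnot]; simp
  have hdiff : ∑ j ∈ classIdx g n 1 (n / (s + 1)), ((n : ℤ) - s * j - (l : ℕ)) -
      ∑ j ∈ classIdx g n 1 (n / (s + 1)), ((n : ℤ) - (s + 1) * j + (l : ℕ)) =
      ∑ j ∈ classIdx g n 1 (n / (s + 1)), ((j : ℤ) - 2 * l) := by
    rw [← sum_sub_distrib]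
    exact sum_congr rfl fun j _ => by ring
  have hn : n ≤ 4 * l * (q + 1) := by
    have h1 : n < (s + 1) * (n / (s + 1) + 1) := Nat.lt_mul_div_succ n (by omega)
    have h2 : n / (s + 1) + 1 ≤ 4 * (q + 1) := by omega
    nlinarith [Nat.mul_le_mul hsl h2]
  have hn' : (n : ℤ) ≤ 4 * l * (q + 1) := by exact_mod_cast hn
  have hq' : 6 * (l : ℤ) ≤ q := by exact_mod_cast hq
  have hl1 : (1 : ℤ) ≤ l := by exact_mod_cast hl0
  nlinarith

/-! ### Few rests have nearly full sum -/

/-- The multisets with elements in `R` and sum at most `N`. -/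
def boundedMultisets (R : Finset ℕ) (N : ℕ) : Finset (Multiset ℕ) :=
  (range (N + 1)).biUnion fun m =>
    ((univ : Finset m.Partition).image Nat.Partition.parts).filter fun t => ∀ i ∈ t, i ∈ R

theorem mem_boundedMultisets {R : Finset ℕ} (hR : 0 ∉ R) {N : ℕ} {t : Multiset ℕ} :
    t ∈ boundedMultisets R N ↔ t.sum ≤ N ∧ ∀ i ∈ t, i ∈ R := by
  simp only [boundedMultisets, mem_biUnion, mem_range, mem_filter, mem_image, mem_univ, true_and]
  constructor
  · rintro ⟨m, hm, ⟨p, rfl⟩, h⟩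
    exact ⟨by rw [p.parts_sum]; omega, h⟩
  · rintro ⟨h1, h2⟩
    refine ⟨t.sum, by omega, ⟨⟨t, fun {i} hi => ?_, rfl⟩, rfl⟩, h2⟩
    exact Nat.pos_of_ne_zero fun h => hR (h ▸ h2 i hi)

/-- Otherwise there are at most `n` distinct parts, each contributing at most `n * n`. -/
theorem exists_large_part_or_count {t : Multiset ℕ} {n : ℕ} (ht : n ^ 3 < t.sum) :
    (∃ p ∈ t, n ≤ p) ∨ ∃ p ∈ t, n ≤ t.count p := by
  by_contra! h
  obtain ⟨h1, h2⟩ := h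
  have hs : t.sum = ∑ p ∈ t.toFinset, t.count p * p := by
    rw [Finset.sum_multiset_count]; simp
  have hc : t.toFinset.card ≤ n := by
    conv_rhs => rw [← card_range n]
    exact card_le_card fun p hp => mem_range.2 (h1 p (Multiset.mem_toFinset.1 hp))
  have hb : ∑ p ∈ t.toFinset, t.count p * p ≤ t.toFinset.card • (n * n) := by
    refine sum_le_card_nsmul _ _ _ fun p hp => ?_
    have hp' := Multiset.mem_toFinset.1 hp
    exact Nat.mul_le_mul (h2 p hp').le (h1 p hp').le
  rw [smul_eq_mul] at hb
  have : t.toFinset.card * (n * n) ≤ n * (n * n) := Nat.mul_le_mul_right _ hc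
  have e : n ^ 3 = n * (n * n) := by ring
  omega

/-- Multisets of nearly full sum are few compared with those of much smaller sum. -/
theorem card_near_le {R : Finset ℕ} (hR : 0 ∉ R) {N n₀ n₁ : ℕ} (h1 : 0 < n₁)
    (hN : n₁ ^ 3 + n₀ ≤ N) :
    ((boundedMultisets R N).filter fun t => N - t.sum < n₀).card ≤
      2 * n₀ * ((boundedMultisets R N).filter fun t => n₁ ≤ N - t.sum).card := by
  classical
  -- Remove one part that is at least `n₁`, or `n₁` copies of one part; either lowers the sum by at
  -- least `n₁`.
  have key : ∀ t ∈ (boundedMultisets R N).filter (fun t => N - t.sum < n₀),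
      ∃ u ∈ (boundedMultisets R N).filter (fun t => n₁ ≤ N - t.sum),
      ∃ c : Bool, ∃ p, t = u + Multiset.replicate (if c then n₁ else 1) p := by
    intro t ht
    rw [mem_filter, mem_boundedMultisets hR] at ht
    have hsum : n₁ ^ 3 < t.sum := by omega
    have aux : ∀ (c : Bool) (p : ℕ), p ∈ t → (if c then n₁ else 1) ≤ t.count p →
        n₁ ≤ (if c then n₁ else 1) * p →
        ∃ u ∈ (boundedMultisets R N).filter (fun t => n₁ ≤ N - t.sum),
        ∃ c : Bool, ∃ p, t = u + Multiset.replicate (if c then n₁ else 1) p := by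
      intro c p hp hcount hbig
      have hle : Multiset.replicate (if c then n₁ else 1) p ≤ t :=
        Multiset.le_count_iff_replicate_le.1 hcount
      obtain ⟨u, hu⟩ := Multiset.le_iff_exists_add.1 hle
      rw [add_comm] at hu
      refine ⟨u, ?_, c, p, hu⟩
      have hs : t.sum = u.sum + (if c then n₁ else 1) * p := by
        conv_lhs => rw [hu]
        simp
      rw [mem_filter, mem_boundedMultisets hR]
      refine ⟨⟨by omega, fun i hi => ht.1.2 i ?_⟩, by omega⟩
      rw [hu]
      exact Multiset.mem_add.2 (Or.inl hi)
    rcases exists_large_part_or_count hsum with ⟨p, hp, hp'⟩ | ⟨p, hp, hp'⟩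
    · exact aux false p hp (by simpa using Multiset.one_le_count_iff_mem.2 hp) (by simpa using hp')
    · refine aux true p hp (by simpa using hp') ?_
      have : 0 < p := Nat.pos_of_ne_zero fun h => hR (h ▸ ht.1.2 p hp)
      simpa using Nat.le_mul_of_pos_right n₁ this
  choose! u hu c p hup using key
  have hcard : (((univ : Finset Bool) ×ˢ range n₀) ×ˢ
      (boundedMultisets R N).filter fun t => n₁ ≤ N - t.sum).card =
      2 * n₀ * ((boundedMultisets R N).filter fun t => n₁ ≤ N - t.sum).card := by
    rw [card_product, card_product, card_range, card_univ, Fintype.card_bool]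
  rw [← hcard]
  -- The removed part `p` need not be recorded: the sums of `t` and `u` and the number of copies
  -- determine it.
  refine card_le_card_of_injOn (fun t => ((c t, N - t.sum), u t)) ?_ ?_
  · intro t ht
    have ht' := (mem_filter.1 (mem_coe.1 ht)).2
    rw [mem_coe, mem_product, mem_product, mem_range]
    exact ⟨⟨mem_univ _, ht'⟩, hu t ht⟩
  · intro t ht t' ht' h
    simp only [Prod.mk.injEq] at h
    obtain ⟨⟨hc, hs⟩, hu'⟩ := h
    have e := hup t ht
    have e' := hup t' ht'
    have m := ((mem_boundedMultisets hR).1 (mem_filter.1 (mem_coe.1 ht)).1).1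
    have m' := ((mem_boundedMultisets hR).1 (mem_filter.1 (mem_coe.1 ht')).1).1
    have hsum : t.sum = t'.sum := by omega
    have s1 : t.sum = (u t).sum + (if c t then n₁ else 1) * p t := by
      conv_lhs => rw [e]
      simp
    have s2 : t'.sum = (u t').sum + (if c t' then n₁ else 1) * p t' := by
      conv_lhs => rw [e']
      simp
    have hpos : 0 < (if c t' then n₁ else 1) := by split_ifs <;> omega
    rw [hc, hu', hsum, s2] at s1
    have hp : p t = p t' := (Nat.eq_of_mul_eq_mul_left hpos (by omega)).symm
    rw [e, e', hc, hu', hp]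

/-- A weight that is eventually large has a positive total over all bounded multisets. -/
theorem sum_boundedMultisets_pos {R : Finset ℕ} (hR : 0 ∉ R) {N n₀ n₁ : ℕ} (h01 : n₀ ≤ n₁)
    (h1 : 0 < n₁) (hN : n₁ ^ 3 + n₀ ≤ N) {h : ℕ → ℤ}
    (hneg : ∀ n < n₀, -(n₀ : ℤ) ^ 2 ≤ h n) (hnn : ∀ n, n₀ ≤ n → 0 ≤ h n)
    (hbig : ∀ n, n₁ ≤ n → 2 * (n₀ : ℤ) ^ 3 < h n) :
    0 < ∑ t ∈ boundedMultisets R N, h (N - t.sum) := by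
  set A := (boundedMultisets R N).filter fun t => N - t.sum < n₀ with hA
  set B := (boundedMultisets R N).filter fun t => n₁ ≤ N - t.sum with hB
  have hcard : A.card ≤ 2 * n₀ * B.card := card_near_le hR h1 hN
  have hBpos : 0 < B.card := by
    rw [card_pos]
    refine ⟨0, ?_⟩
    rw [hB, mem_filter, mem_boundedMultisets hR]
    have : n₁ ≤ n₁ ^ 3 := Nat.le_self_pow (by norm_num) _
    simp
    omega
  have hsplit : ∑ t ∈ boundedMultisets R N, ((if N - t.sum < n₀ then -(n₀ : ℤ) ^ 2 else 0) +
      (if n₁ ≤ N - t.sum then 2 * (n₀ : ℤ) ^ 3 + 1 else 0)) ≤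
      ∑ t ∈ boundedMultisets R N, h (N - t.sum) := by
    refine sum_le_sum fun t _ => ?_
    split_ifs with i1 i2 i2
    · omega
    · simpa using hneg _ i1
    · have := hbig _ i2
      omega
    · simpa using hnn _ (not_lt.1 i1)
  refine lt_of_lt_of_le ?_ hsplit
  rw [sum_add_distrib, ← sum_filter, ← sum_filter, sum_const, sum_const, nsmul_eq_mul,
    nsmul_eq_mul, ← hA, ← hB]
  have hcard' : (A.card : ℤ) ≤ 2 * n₀ * B.card := by exact_mod_cast hcard
  have hBpos' : (0 : ℤ) < B.card := by exact_mod_cast hBpos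
  nlinarith [mul_le_mul_of_nonneg_right hcard' (sq_nonneg (n₀ : ℤ))]

/-! ### Splitting partitions into a rest and three multiplicities -/

/-- The multiset with rest `t` and prescribed multiplicities of three further parts. -/
def assemble (c a b : ℕ) (t : Multiset ℕ) (p : ℕ × ℕ × ℕ) : Multiset ℕ :=
  t + Multiset.replicate p.1 c + Multiset.replicate p.2.1 a + Multiset.replicate p.2.2 b

theorem sum_assemble (c a b : ℕ) (t : Multiset ℕ) (p : ℕ × ℕ × ℕ) :
    (assemble c a b t p).sum = t.sum + (c * p.1 + a * p.2.1 + b * p.2.2) := by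
  simp [assemble]; ring

theorem mem_assemble {c a b i : ℕ} {t : Multiset ℕ} {p : ℕ × ℕ × ℕ}
    (h : i ∈ assemble c a b t p) : i ∈ t ∨ i = c ∨ i = a ∨ i = b := by
  simp only [assemble, Multiset.mem_add, Multiset.mem_replicate] at h
  tauto

theorem count_assemble (c a b i : ℕ) (t : Multiset ℕ) (p : ℕ × ℕ × ℕ) :
    (assemble c a b t p).count i = t.count i + (if c = i then p.1 else 0) +
      (if a = i then p.2.1 else 0) + (if b = i then p.2.2 else 0) := by
  simp [assemble, Multiset.count_replicate]

theorem assemble_injective {R : Finset ℕ} {c a b : ℕ} (hc : c ∉ R) (ha : a ∉ R) (hb : b ∉ R)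
    (hca : c ≠ a) (hcb : c ≠ b) (hab : a ≠ b) {t t' : Multiset ℕ} (ht : ∀ i ∈ t, i ∈ R)
    (ht' : ∀ i ∈ t', i ∈ R) {p p' : ℕ × ℕ × ℕ}
    (h : assemble c a b t p = assemble c a b t' p') : t = t' ∧ p = p' := by
  have hcount : ∀ i, i ∉ R → t.count i = 0 ∧ t'.count i = 0 := fun i hi =>
    ⟨Multiset.count_eq_zero.2 fun h => hi (ht i h), Multiset.count_eq_zero.2 fun h => hi (ht' i h)⟩
  have key := fun i => congrArg (Multiset.count i) h
  simp only [count_assemble] at key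
  have kc := key c
  have ka := key a
  have kb := key b
  simp only [hcount c hc, hcount a ha, hcount b hb, hca, hcb, hab, hca.symm, hcb.symm, hab.symm,
    if_true, if_false, zero_add, add_zero] at kc ka kb
  refine ⟨?_, Prod.ext kc (Prod.ext ka kb)⟩
  ext i
  have := key i
  rw [kc, ka, kb] at this
  omega

theorem eq_assemble {c a b : ℕ} (hca : c ≠ a) (hcb : c ≠ b) (hab : a ≠ b) (u : Multiset ℕ) :
    u = assemble c a b (u.filter fun i => i ≠ c ∧ i ≠ a ∧ i ≠ b)
      (u.count c, u.count a, u.count b) := by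
  ext i
  rw [count_assemble, Multiset.count_filter]
  by_cases h1 : c = i
  · subst h1; simp [hca.symm, hcb.symm]
  by_cases h2 : a = i
  · subst h2; simp [hca, hab.symm]
  by_cases h3 : b = i
  · subst h3; simp [hcb, hab]
  simp [h1, h2, h3, Ne.symm h1, Ne.symm h2, Ne.symm h3]

theorem card_partD_le {L s k a b N : ℕ} (hk : k ∈ Icc (s + 1) (L + s))
    (ha : a ∈ Icc (s + 1) (L + s)) (hb : b ∈ Icc (s + 1) (L + s))
    (hka : k ≠ a) (hkb : k ≠ b) (hab : a ≠ b) :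
    (partD L s N).card ≤ ∑ t ∈ boundedMultisets
      ((Icc (s + 1) (L + s)).filter fun i => i ≠ k ∧ i ≠ a ∧ i ≠ b) N,
      (triples 0 k a b (N - t.sum)).card := by
  rw [mem_Icc] at hk ha hb
  rw [← card_sigma]
  refine card_le_card_of_injOn (fun π => ⟨π.parts.filter fun i => i ≠ k ∧ i ≠ a ∧ i ≠ b,
    (π.parts.count k, π.parts.count a, π.parts.count b)⟩) ?_ ?_
  · intro π hπ
    have hmem := (mem_filter.1 (mem_coe.1 hπ)).2.2
    have hsum := congrArg Multiset.sum (eq_assemble hka hkb hab π.parts)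
    rw [π.parts_sum, sum_assemble] at hsum
    rw [mem_coe, mem_sigma, mem_boundedMultisets (by simp),
      mem_triples (by omega) (by omega) (by omega)]
    dsimp only at hsum ⊢
    refine ⟨⟨by omega, fun i hi => ?_⟩, Nat.zero_le _, by omega⟩
    rw [Multiset.mem_filter] at hi
    exact mem_filter.2 ⟨hmem i hi.1, hi.2⟩
  · intro π _ π' _ h
    simp only [Sigma.mk.injEq, heq_eq_eq, Prod.mk.injEq] at h
    ext1
    rw [eq_assemble hka hkb hab π.parts, eq_assemble hka hkb hab π'.parts, h.1, h.2.1, h.2.2.1,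
      h.2.2.2]

theorem le_card_partI {L s k a b N : ℕ} (hs : 1 ≤ s) (hk : s + 1 ≤ k)
    (ha : a ∈ Icc (s + 1) (L + s)) (hb : b ∈ Icc (s + 1) (L + s))
    (hka : k ≠ a) (hkb : k ≠ b) (hab : a ≠ b) :
    ∑ t ∈ boundedMultisets ((Icc (s + 1) (L + s)).filter fun i => i ≠ k ∧ i ≠ a ∧ i ≠ b) N,
      (triples 1 s a b (N - t.sum)).card ≤ (partI L s k N).card := by
  rw [mem_Icc] at ha hb
  rw [← card_sigma, ← card_map ⟨Nat.Partition.parts, fun _ _ => Nat.Partition.ext⟩]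
  refine card_le_card_of_injOn (fun x => assemble s a b x.1 x.2) ?_ ?_
  · rintro ⟨t, p⟩ hx
    rw [mem_coe, mem_sigma, mem_boundedMultisets (by simp),
      mem_triples (by omega) (by omega) (by omega)] at hx
    dsimp only at hx
    obtain ⟨⟨ht, htR⟩, hp1, hp⟩ := hx
    have hmem : ∀ i ∈ assemble s a b t p, s ≤ i ∧ i ≤ L + s ∧ i ≠ k := by
      intro i hi
      rcases mem_assemble hi with h | h | h | h
      · have := htR i h
        rw [mem_filter, mem_Icc] at this
        omega
      all_goals omega
    rw [mem_coe, mem_map]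
    refine ⟨⟨assemble s a b t p, fun {i} hi => by have := hmem i hi; omega, ?_⟩, ?_, rfl⟩
    · rw [sum_assemble]; omega
    · rw [partI, mem_filter]
      refine ⟨mem_univ _, ⟨?_, fun i hi => (hmem i hi).1⟩, fun i hi => (hmem i hi).2.1,
        fun hi => (hmem k hi).2.2 rfl⟩
      simp only [assemble, Multiset.mem_add, Multiset.mem_replicate]
      exact Or.inl (Or.inl (Or.inr ⟨by omega, trivial⟩))
  · rintro ⟨t, p⟩ hx ⟨t', p'⟩ hx' h
    rw [mem_coe, mem_sigma, mem_boundedMultisets (by simp)] at hx hx'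
    obtain ⟨rfl, rfl⟩ := assemble_injective (by simp) (by simp) (by simp) (by omega) (by omega)
      hab hx.1.2 hx'.1.2 h
    rfl

/-! ### The threshold, the two auxiliary parts, and the conclusion -/

/-- The left side is `n₁ ^ 3 + n₀`. With `Q = P (3 * s + 2) s`, both `24` and `s + 3` are at most
`Q`, so it is at most `Q ^ 42 + Q ^ 4`, while `GammaBound s` is at least `Q ^ 43`. -/
theorem le_GammaBound {s : ℕ} (hs : 1 ≤ s) :
    (20 * (s + 3) * (24 * (s + 3) ^ 3) ^ 3) ^ 3 + 24 * (s + 3) ^ 3 ≤ GammaBound s := by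
  have hQ : (s + 1) * (s + 2) * (s + 3) ≤ P (3 * s + 2) s := by
    have h : ∏ i ∈ Icc 1 3, (s + i) ≤ P (3 * s + 2) s :=
      prod_le_prod_of_subset_of_one_le' (Icc_subset_Icc_right (by omega)) fun i _ _ => by omega
    have e : ∏ i ∈ Icc 1 3, (s + i) = (s + 1) * (s + 2) * (s + 3) := by
      simp [← Ico_add_one_right_eq_Icc, prod_Ico_eq_prod_range, prod_range_succ]
    rwa [e] at h
  have hsum : 1 ≤ ∑ i ∈ Icc 1 (3 * s + 2), (s + i) := by
    have : s + 1 ≤ ∑ i ∈ Icc 1 (3 * s + 2), (s + i) :=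
      single_le_sum (f := fun i => s + i) (fun _ _ => Nat.zero_le _) (by simp)
    omega
  have hX : s + 3 ≤ P (3 * s + 2) s := by
    refine le_trans ?_ hQ
    exact Nat.le_mul_of_pos_left _ (by positivity)
  have h24 : 24 ≤ P (3 * s + 2) s := by
    refine le_trans ?_ hQ
    exact Nat.mul_le_mul (Nat.mul_le_mul (by omega : 2 ≤ s + 1) (by omega : 3 ≤ s + 2))
      (by omega : 4 ≤ s + 3)
  rw [GammaBound, gammaBound]
  generalize P (3 * s + 2) s = Q at hX h24
  have hexp : 43 ≤ (Q ^ 2 - 1) * (3 * s + 2) + 2 := by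
    have h1 : 24 ^ 2 ≤ Q ^ 2 := Nat.pow_le_pow_left h24 2
    have h2 : 41 * 1 ≤ (Q ^ 2 - 1) * (3 * s + 2) := Nat.mul_le_mul (by omega) (by omega)
    omega
  calc (20 * (s + 3) * (24 * (s + 3) ^ 3) ^ 3) ^ 3 + 24 * (s + 3) ^ 3
      ≤ (Q * Q * (Q * Q ^ 3) ^ 3) ^ 3 + Q * Q ^ 3 := by gcongr; omega
    _ = Q ^ 42 + Q ^ 4 := by ring
    _ ≤ Q ^ 42 + Q ^ 42 := Nat.add_le_add_left (Nat.pow_le_pow_right (by omega) (by norm_num)) _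
    _ = 2 * Q ^ 42 := by ring
    _ ≤ Q * Q ^ 42 := Nat.mul_le_mul_right _ (by omega)
    _ = Q ^ 43 := by ring
    _ ≤ Q ^ ((Q ^ 2 - 1) * (3 * s + 2) + 2) := Nat.pow_le_pow_right (by omega) hexp
    _ ≤ Q ^ ((Q ^ 2 - 1) * (3 * s + 2) + 2) + ((Q ^ 2 - 1) * (3 * s + 2) - 2) * Q :=
      Nat.le_add_right _ _
    _ ≤ _ := Nat.le_mul_of_pos_left _ hsum

theorem exists_parts (s k : ℕ) :
    ∃ g a b : ℕ, (g = 1 ∨ g = 2) ∧ Nat.Coprime a b ∧ g ∣ s + 1 ∧ (g ∣ k + 1) ∧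
      s + 1 ≤ g * a ∧ g * a < g * b ∧ g * b ≤ s + 3 ∧ k ≠ g * a ∧ k ≠ g * b := by
  have consec : ∀ n, Nat.Coprime n (n + 1) := fun n => by simp
  by_cases h1 : k = s + 1
  · exact ⟨1, s + 2, s + 3, by simp, consec _, by simp, by simp, by omega, by omega, by omega,
      by omega, by omega⟩
  by_cases h2 : k = s + 2
  · rcases Nat.even_or_odd' s with ⟨m, hm | hm⟩
    · refine ⟨1, s + 1, s + 3, by simp, ?_, by simp, by simp, by omega, by omega, by omega,
        by omega, by omega⟩
      have : Nat.Coprime (s + 1) 2 := by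
        rw [Nat.coprime_two_right]; exact ⟨m, by omega⟩
      have e : s + 3 = 2 + (s + 1) := by omega
      rw [e, Nat.coprime_add_self_right]
      exact this
    -- The only case with `g = 2`: `s` and `k = s + 2` are odd, and the parts are `s + 1` and `s +
    -- 3`.
    · exact ⟨2, m + 1, m + 2, by simp, consec _, ⟨m + 1, by omega⟩, ⟨m + 2, by omega⟩, by omega,
        by omega, by omega, by omega, by omega⟩
  · exact ⟨1, s + 1, s + 2, by simp, consec _, by simp, by simp, by omega, by omega, by omega,
      by omega, by omega⟩

end IntervalPartition

open IntervalPartition Finset in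
theorem mainTheorem2 (L s k : ℕ) (hL : 3 ≤ L) (hs : 1 ≤ s) (hsk : s + 1 ≤ k) (hkL : k ≤ L + s)
    (N : ℕ) (hN : IntervalPartition.GammaBound s ≤ N) :
    (IntervalPartition.partD L s N).card < (IntervalPartition.partI L s k N).card := by
  obtain ⟨g, a, b, hg, hab, hgs, hgk, hsa, hlt, hbs, hka, hkb⟩ := exists_parts s k
  have ha : 0 < a := Nat.pos_of_ne_zero fun h => by simp [h] at hsa
  have hb : 0 < b := Nat.pos_of_ne_zero fun h => by simp [h] at hlt
  have hk : k ∈ Icc (s + 1) (L + s) := mem_Icc.2 ⟨hsk, hkL⟩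
  have hga : g * a ∈ Icc (s + 1) (L + s) := mem_Icc.2 (by omega)
  have hgb : g * b ∈ Icc (s + 1) (L + s) := mem_Icc.2 (by omega)
  have hD := card_partD_le (N := N) hk hga hgb hka hkb hlt.ne
  have hI := le_card_partI (N := N) hs hsk hga hgb hka hkb hlt.ne
  refine hD.trans_lt (lt_of_lt_of_le ?_ hI)
  have hl1 : s + 1 ≤ g * a * b := hsa.trans (Nat.le_mul_of_pos_right _ hb)
  have hl2 : g * a * b ≤ (s + 3) ^ 2 := by
    rw [sq]
    refine Nat.mul_le_mul (by omega) (le_trans ?_ hbs)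
    exact Nat.le_mul_of_pos_left _ (by omega)
  have hexcess := fun n (hq : 6 * (g * a * b) ≤ n / (s + 1) / 4) =>
    lcm_mul_card_triples_sub (n := n) hg ha hb hab hs hgs hsk hgk hl1 hq rfl
  have hl0 : (0 : ℤ) < ((g * a * b : ℕ) : ℤ) := by
    have : 0 < g * a * b := by omega
    exact_mod_cast this
  have hq₀ : ∀ n, 24 * (s + 3) ^ 3 ≤ n → 6 * (g * a * b) ≤ n / (s + 1) / 4 := by
    intro n hn
    refine (Nat.mul_le_mul_left 6 hl2).trans ?_
    rw [Nat.div_div_eq_div_mul, Nat.le_div_iff_mul_le (by omega)]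
    refine le_trans ?_ hn
    calc 6 * (s + 3) ^ 2 * ((s + 1) * 4) ≤ 6 * (s + 3) ^ 2 * ((s + 3) * 4) := by gcongr; omega
      _ = 24 * (s + 3) ^ 3 := by ring
  have hn₀ : 1 ≤ 24 * (s + 3) ^ 3 := Nat.mul_pos (by norm_num) (by positivity)
  have h01 : 24 * (s + 3) ^ 3 ≤ 20 * (s + 3) * (24 * (s + 3) ^ 3) ^ 3 :=
    (Nat.le_self_pow (by norm_num) _).trans (Nat.le_mul_of_pos_left _ (by omega))
  have hpos := sum_boundedMultisets_pos
    (R := (Icc (s + 1) (L + s)).filter fun i => i ≠ k ∧ i ≠ g * a ∧ i ≠ g * b) (by simp)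
    h01 (hn₀.trans h01) ((le_GammaBound hs).trans hN)
    (h := fun n => ((triples 1 s (g * a) (g * b) n).card : ℤ) -
      (triples 0 k (g * a) (g * b) n).card) ?_ ?_ ?_
  · rw [sum_sub_distrib, sub_pos] at hpos
    exact_mod_cast hpos
  · intro n hn
    have h1 : (triples 0 k (g * a) (g * b) n).card ≤ (24 * (s + 3) ^ 3) ^ 2 :=
      (card_triples_le (Nat.mul_pos (by omega) hb)).trans (Nat.pow_le_pow_left hn 2)
    have h2 : ((triples 0 k (g * a) (g * b) n).card : ℤ) ≤
        ((24 * (s + 3) ^ 3 : ℕ) : ℤ) ^ 2 := by exact_mod_cast h1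
    have h3 : (0 : ℤ) ≤ (triples 1 s (g * a) (g * b) n).card := Int.natCast_nonneg _
    linarith
  · intro n hn
    have hq := hq₀ n hn
    have h := hexcess n hq
    generalize n / (s + 1) / 4 = q at hq h
    have hq' : 6 * ((g * a * b : ℕ) : ℤ) ≤ q := by exact_mod_cast hq
    refine nonneg_of_mul_nonneg_right (le_trans ?_ h) hl0
    nlinarith
  · intro n hn
    have hq := hq₀ n (h01.trans hn)
    have h := hexcess n hq
    have hq2 : 4 * (24 * (s + 3) ^ 3) ^ 3 ≤ n / (s + 1) / 4 := by
      rw [Nat.div_div_eq_div_mul, Nat.le_div_iff_mul_le (by omega)]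
      refine le_trans ?_ hn
      calc 4 * (24 * (s + 3) ^ 3) ^ 3 * ((s + 1) * 4)
          ≤ 4 * (24 * (s + 3) ^ 3) ^ 3 * ((s + 3) * 5) := by gcongr <;> omega
        _ = 20 * (s + 3) * (24 * (s + 3) ^ 3) ^ 3 := by ring
    have hq' : 6 * ((g * a * b : ℕ) : ℤ) ≤ (n / (s + 1) / 4 : ℕ) := by exact_mod_cast hq
    have hq2' : 4 * ((24 * (s + 3) ^ 3 : ℕ) : ℤ) ^ 3 ≤ (n / (s + 1) / 4 : ℕ) := by
      exact_mod_cast hq2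
    have hY : (0 : ℤ) < ((24 * (s + 3) ^ 3 : ℕ) : ℤ) ^ 3 := by positivity
    generalize ((n / (s + 1) / 4 : ℕ) : ℤ) = q at h hq' hq2'
    generalize ((24 * (s + 3) ^ 3 : ℕ) : ℤ) ^ 3 = Y at hq2' hY ⊢
    refine lt_of_mul_lt_mul_left (lt_of_lt_of_le ?_ h) hl0.le
    -- With `l = g * a * b`: `q ≥ 6 l` gives `9 l² ≤ q² / 4`, and `q² ≥ 6 l * 4 Y`, so `q² - 9 l² ≥
    -- 18 l Y > 2 l Y`.
    nlinarith [mul_le_mul hq' hq2' (by positivity) (by linarith), mul_pos hl0 hY]
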